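/- Let $d\ge 2$ be an integer and $\alpha\in(0,1)$. There is a constant $C=C(\alpha,d)>0$ such that for every set $E\subset\mathbb{R}^d$ of finite perimeter $$\|\mathcal{D}^{1-\alpha}(\chi_E)\|_{L^{d/(d-\alpha),1}(\mathbb{R}^d)}\le C\,\mathrm{Per}(E)^{1-\alpha}\,|E|^{\alpha(1-1/d)}.$$ Here $|E|$ is the Lebesgue measure of $E$, $\chi_E$ is its characteristic function, and $$\mathcal{D}^{1-\alpha}(u)(x)=\int_{\mathbb{R}^d}\frac{|u(x)-u(y)|}{|x-y|^{d+1-\alpha}}\,dy\in[0,\infty].$$ The set $E$ has finite perimeter if it is Lebesgue measurable, $|E|<\infty$, and $$\mathrm{Per}(E)=\sup\Big\{\Big|\int_{\mathbb{R}^d}\chi_E\,\operatorname{div}\Phi\,dx\Big| : \Phi\in C^1_c(\mathbb{R}^d;\mathbb{R}^d),\ \|\Phi\|_{L^\infty}\le 1\Big\}<\infty .$$ For $1<q<\infty$ the Lorentz norm is $$\|f\|_{L^{q,1}(\mathbb{R}^d)}=\int_0^\infty t^{1/q}f^{**}(t)\,\frac{dt}{t},\qquad f^{**}(t)=\frac1t\int_0^t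 f^*(s)\,ds,$$ where $f^*(t)=\inf\{y\ge 0: |\{|f|>y\}|<t\}$, $t>0$, is the left-continuous non-increasing rearrangement of $f$. -/

import Mathlib

open MeasureTheory Set
open scoped ENNReal NNReal

noncomputable section

namespace FracPerimeter

/-- The divergence `∑ i, ∂ᵢ Φᵢ` of a vector field on `ℝ^d`. -/
def divergence {d : ℕ} (Φ : EuclideanSpace ℝ (Fin d) → EuclideanSpace ℝ (Fin d))
    (x : EuclideanSpace ℝ (Fin d)) : ℝ :=
  ∑ i : Fin d, (fderiv ℝ Φ x (EuclideanSpace.single i 1)) i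

/-- The competitors in the definition of the total variation: `C¹` compactly supported vector
fields with sup norm (with respect to the Euclidean norm) at most one. -/
def testFields (d : ℕ) : Set (EuclideanSpace ℝ (Fin d) → EuclideanSpace ℝ (Fin d)) :=
  {Φ | ContDiff ℝ 1 Φ ∧ HasCompactSupport Φ ∧ ∀ x, ‖Φ x‖ ≤ 1}

/-- The total variation `|Du|(ℝ^d) = sup_Φ |∫ u div Φ|`, as an extended nonnegative number. -/
def totalVariation {d : ℕ} (u : EuclideanSpace ℝ (Fin d) → ℝ) : ℝ≥0∞ :=
  ⨆ Φ ∈ testFields d, ENNReal.ofReal |∫ x, u x * divergence Φ x|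

/-- `u ∈ BV(ℝ^d)`: `u` is in `L¹` and has finite total variation. -/
def IsBV {d : ℕ} (u : EuclideanSpace ℝ (Fin d) → ℝ) : Prop :=
  Integrable u ∧ totalVariation u < ∞

/-- The characteristic function of a set. -/
def chi {d : ℕ} (E : Set (EuclideanSpace ℝ (Fin d))) : EuclideanSpace ℝ (Fin d) → ℝ :=
  E.indicator fun _ => 1

/-- `E` has finite perimeter: `|E| < ∞` and `χ_E ∈ BV(ℝ^d)`. (The integrability of `χ_E` contains
the Lebesgue measurability of `E`.) -/
def HasFinitePerimeter {d : ℕ} (E : Set (EuclideanSpace ℝ (Fin d))) : Prop :=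
  volume E < ∞ ∧ IsBV (chi E)

/-- `Per(E) = |Dχ_E|(ℝ^d)`. -/
def perimeter {d : ℕ} (E : Set (EuclideanSpace ℝ (Fin d))) : ℝ≥0∞ :=
  totalVariation (chi E)

/-- The nonlinear fractional derivative of order `s`,
`𝒟^s(u)(x) = ∫ |u(x) - u(y)| / |x - y|^(d + s) dy ∈ [0, ∞]`. -/
def fracDeriv {d : ℕ} (s : ℝ) (u : EuclideanSpace ℝ (Fin d) → ℝ)
    (x : EuclideanSpace ℝ (Fin d)) : ℝ≥0∞ :=
  ∫⁻ y, ENNReal.ofReal (|u x - u y| / ‖x - y‖ ^ ((d : ℝ) + s))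

/-- The distribution function `m(f, y) = |{f > y}|` of a nonnegative function. -/
def distribution {d : ℕ} (f : EuclideanSpace ℝ (Fin d) → ℝ≥0∞) (y : ℝ≥0∞) : ℝ≥0∞ :=
  volume {x | y < f x}

/-- The non-increasing rearrangement `f^*` on `(0, ∞)`: the left-continuous inverse
`f^*(t) = inf {y ≥ 0 : m(f, y) < t}` of the distribution function. -/
def rearrangement {d : ℕ} (f : EuclideanSpace ℝ (Fin d) → ℝ≥0∞) (t : ℝ) : ℝ≥0∞ :=
  sInf {y | distribution f y < ENNReal.ofReal t}

/-- `f^{**}(t) = (1/t) ∫_0^t f^*(s) ds` for `t > 0`. -/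
def averagedRearrangement {d : ℕ} (f : EuclideanSpace ℝ (Fin d) → ℝ≥0∞) (t : ℝ) : ℝ≥0∞ :=
  (∫⁻ s in Ioc 0 t, rearrangement f s) / ENNReal.ofReal t

/-- The Lorentz norm `‖f‖_{L^{q,r}} = (∫_0^∞ [t^{1/q} f^{**}(t)]^r dt/t)^{1/r}` of a
nonnegative function, for `1 < q < ∞` and `1 ≤ r < ∞`. -/
def lorentzNorm {d : ℕ} (q r : ℝ) (f : EuclideanSpace ℝ (Fin d) → ℝ≥0∞) : ℝ≥0∞ :=
  (∫⁻ t in Ioi (0 : ℝ),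
    (ENNReal.ofReal t ^ (1 / q) * averagedRearrangement f t) ^ r / ENNReal.ofReal t) ^ (1 / r)

end FracPerimeter

end

/-! Write f = 𝒟^{1-α}(χ_E), P = Per(E), v = |E|, and cut the integral defining f at |x - y| = r. By
duality, translating E by h changes χ_E by at most 2P|h| in L¹ (from
`volume_setOf_translate_notMem_le`), so the near part has L¹ norm ≲ P r^α. The far part is ≲ r^{α-1}
pointwise and ≲ v r^{α-1} in L¹. Since ∫₀ᵗ f^* ≤ ‖g‖₁ + tM whenever f ≤ g + M, this gives ∫₀ᵗ f^* ≲
P r^α + min(t, v) r^{α-1} (`exists_lintegral_rearrangement_fracDeriv_le`).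

The choice r = min(t, v)/P turns the bound into P^{1-α} min(t, v)^α. With 1/q = 1 - α/d, the Lorentz
norm is then controlled by P^{1-α} ∫ t^{-1-α/d} min(t, v)^α dt. This converges at 0 because α/d < α
and at ∞ because α/d > 0, and it scales like v^{α-α/d} (`lintegral_rpow_mul_min_rpow_le`). -/

namespace FracPerimeter

/-! ### Rearrangements and the bound for ∫₀ᵗ f^*. -/

theorem rearrangement_antitone {d : ℕ} (f : EuclideanSpace ℝ (Fin d) → ℝ≥0∞) :
    Antitone (rearrangement f) := fun _ _ hst =>
  sInf_le_sInf fun _ hy => lt_of_lt_of_le hy (ENNReal.ofReal_le_ofReal hst)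

theorem rearrangement_congr_ae {d : ℕ} {f g : EuclideanSpace ℝ (Fin d) → ℝ≥0∞}
    (h : f =ᵐ[volume] g) : rearrangement f = rearrangement g := by
  have : distribution f = distribution g := by
    funext y
    refine measure_congr ?_
    filter_upwards [h] with x hx
    exact congrArg (fun z => y < z) hx
  funext t
  simp only [rearrangement, this]

theorem lorentzNorm_congr_ae {d : ℕ} {f g : EuclideanSpace ℝ (Fin d) → ℝ≥0∞}
    (h : f =ᵐ[volume] g) (q r : ℝ) : lorentzNorm q r f = lorentzNorm q r g := by
  simp only [lorentzNorm, averagedRearrangement, rearrangement_congr_ae h]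

/-- {f > y + M} is contained in {g > y}. -/
theorem rearrangement_le_add_const {d : ℕ} {f g : EuclideanSpace ℝ (Fin d) → ℝ≥0∞} {M : ℝ≥0∞}
    (h : ∀ x, f x ≤ g x + M) (t : ℝ) : rearrangement f t ≤ rearrangement g t + M := by
  rw [rearrangement, rearrangement, ENNReal.sInf_add]
  refine le_iInf₂ fun y hy => sInf_le ?_
  refine lt_of_le_of_lt (measure_mono fun x hx => ?_) hy
  by_contra hxy
  exact absurd (lt_of_lt_of_le hx (h x)) (not_lt.2 (by gcongr; exact not_lt.1 hxy))

theorem volume_setOf_ofReal_lt (a : ℝ≥0∞) :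
    volume.restrict (Ioi (0 : ℝ)) {y | ENNReal.ofReal y < a} = a := by
  rw [Measure.restrict_apply (measurableSet_lt ENNReal.measurable_ofReal measurable_const)]
  induction a with
  | top => simp
  | coe a =>
    have : {y : ℝ | ENNReal.ofReal y < a} ∩ Ioi 0 = Ioo 0 (a : ℝ) := by
      ext y
      simp only [mem_inter_iff, mem_ofPred_eq, mem_Ioi, mem_Ioo]
      constructor
      · rintro ⟨h, h0⟩
        exact ⟨h0, by simpa using (ENNReal.ofReal_lt_iff_lt_toReal h0.le ENNReal.coe_ne_top).1 h⟩
      · rintro ⟨h0, h⟩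
        exact ⟨(ENNReal.ofReal_lt_iff_lt_toReal h0.le ENNReal.coe_ne_top).2 (by simpa using h), h0⟩
    rw [this]
    simp

/-- Layer cake formula for functions with values in `[0, ∞]`. -/
theorem lintegral_eq_lintegral_measure_lt {X : Type*} [MeasurableSpace X] (μ : Measure X)
    [SFinite μ] {f : X → ℝ≥0∞} (hf : Measurable f) :
    ∫⁻ x, f x ∂μ = ∫⁻ y in Ioi (0 : ℝ), μ {x | ENNReal.ofReal y < f x} := by
  have hm : MeasurableSet {p : X × ℝ | ENNReal.ofReal p.2 < f p.1} :=
    measurableSet_lt (by fun_prop) (by fun_prop)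
  calc ∫⁻ x, f x ∂μ
      = ∫⁻ x, (volume.restrict (Ioi (0 : ℝ))) (Prod.mk x ⁻¹' {p | ENNReal.ofReal p.2 < f p.1})
          ∂μ := by
        refine lintegral_congr fun x => (volume_setOf_ofReal_lt (f x)).symm
    _ = _ := by
        rw [← Measure.prod_apply hm, Measure.prod_apply_symm hm]
        rfl

/-- Layer cake on both sides: f^*(s) > y forces s ≤ |{f > y}|. Equality is not needed. -/
theorem lintegral_rearrangement_le {d : ℕ} {f : EuclideanSpace ℝ (Fin d) → ℝ≥0∞}
    (hf : Measurable f) : ∫⁻ s in Ioi (0 : ℝ), rearrangement f s ≤ ∫⁻ x, f x := by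
  rw [lintegral_eq_lintegral_measure_lt _ (rearrangement_antitone f).measurable,
    lintegral_eq_lintegral_measure_lt _ hf]
  refine lintegral_mono fun y => ?_
  have hsub : {s | ENNReal.ofReal y < rearrangement f s} ⊆
      {s | ENNReal.ofReal s ≤ distribution f (ENNReal.ofReal y)} := fun s hs => by
    by_contra h
    exact (mem_ofPred_eq.mp hs).not_ge (sInf_le (mem_ofPred_eq.mpr (not_le.1 h)))
  refine (measure_mono hsub).trans ?_
  change _ ≤ distribution f (ENNReal.ofReal y)
  generalize distribution f (ENNReal.ofReal y) = a
  induction a with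
  | top => exact le_top
  | coe a =>
    rw [Measure.restrict_apply (measurableSet_le ENNReal.measurable_ofReal measurable_const)]
    calc _ ≤ volume (Ioc 0 (a : ℝ)) := measure_mono fun s hs =>
          ⟨hs.2, by simpa using hs.1⟩
      _ = a := by simp

/-- The elementary half of the identity between `∫₀ᵗ f^*` and the `K`-functional of the couple
`(L¹, L^∞)`. -/
theorem lintegral_rearrangement_le_add {d : ℕ} {f g : EuclideanSpace ℝ (Fin d) → ℝ≥0∞}
    (hg : Measurable g) {M : ℝ≥0∞} (h : ∀ x, f x ≤ g x + M) (t : ℝ) :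
    ∫⁻ s in Ioc 0 t, rearrangement f s ≤ (∫⁻ x, g x) + M * ENNReal.ofReal t :=
  calc ∫⁻ s in Ioc 0 t, rearrangement f s
      ≤ ∫⁻ s in Ioc 0 t, (rearrangement g s + M) :=
        lintegral_mono fun s => rearrangement_le_add_const h s
    _ = (∫⁻ s in Ioc 0 t, rearrangement g s) + M * ENNReal.ofReal t := by
        rw [lintegral_add_right _ measurable_const]; simp
    _ ≤ _ := by
        gcongr
        exact (lintegral_mono_set Ioc_subset_Ioi_self).trans (lintegral_rearrangement_le hg)

/-! ### Translation estimates from the total variation. -/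

theorem abs_integral_mul_divergence_le {d : ℕ} {u : EuclideanSpace ℝ (Fin d) → ℝ}
    (hu : totalVariation u < ∞) {Φ : EuclideanSpace ℝ (Fin d) → EuclideanSpace ℝ (Fin d)}
    (hΦ : Φ ∈ testFields d) :
    |∫ x, u x * divergence Φ x| ≤ (totalVariation u).toReal := by
  rw [← ENNReal.ofReal_le_iff_le_toReal hu.ne]
  exact le_iSup₂ (f := fun Φ (_ : Φ ∈ testFields d) =>
    ENNReal.ofReal |∫ x, u x * divergence Φ x|) Φ hΦ

theorem divergence_smul_const {d : ℕ} {φ : EuclideanSpace ℝ (Fin d) → ℝ}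
    (hφ : ContDiff ℝ 1 φ) (v x : EuclideanSpace ℝ (Fin d)) :
    divergence (fun x => φ x • v) x = fderiv ℝ φ x v := by
  have hd : DifferentiableAt ℝ φ x := hφ.differentiable one_ne_zero x
  have hv : v = ∑ i, v i • EuclideanSpace.single i (1 : ℝ) := by
    have := (EuclideanSpace.basisFun (Fin d) ℝ).sum_repr v
    simpa using this.symm
  rw [divergence, fderiv_smul_const hd v]
  conv_rhs => rw [hv, map_sum]
  refine Finset.sum_congr rfl fun i _ => ?_
  simp [mul_comm]

/-- The field φ v/‖v‖ is an admissible competitor, with divergence ∂_v φ/‖v‖. -/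
theorem abs_integral_mul_fderiv_le {d : ℕ} {u : EuclideanSpace ℝ (Fin d) → ℝ}
    (hu : totalVariation u < ∞) {φ : EuclideanSpace ℝ (Fin d) → ℝ}
    (hφ : ContDiff ℝ 1 φ) (hc : HasCompactSupport φ) (h1 : ∀ x, |φ x| ≤ 1)
    (v : EuclideanSpace ℝ (Fin d)) :
    |∫ x, u x * fderiv ℝ φ x v| ≤ ‖v‖ * (totalVariation u).toReal := by
  rcases eq_or_ne v 0 with rfl | hv
  · simp
  have hv' : ‖v‖ ≠ 0 := norm_ne_zero_iff.2 hv
  have hmem : (fun x => φ x • (‖v‖⁻¹ • v)) ∈ testFields d := by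
    refine ⟨hφ.smul contDiff_const, hc.smul_right, fun x => ?_⟩
    rw [norm_smul, norm_smul, norm_inv, norm_norm, inv_mul_cancel₀ hv', mul_one]
    exact h1 x
  have key := abs_integral_mul_divergence_le hu hmem
  have heq : ∫ x, u x * fderiv ℝ φ x v =
      ‖v‖ * ∫ x, u x * divergence (fun x => φ x • (‖v‖⁻¹ • v)) x := by
    rw [← integral_const_mul]
    refine integral_congr_ae (.of_forall fun x => ?_)
    simp only [divergence_smul_const hφ, map_smul, smul_eq_mul]
    field_simp
  rw [heq, abs_mul, abs_norm]
  gcongr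

/-- Translation estimate against a test function. -/
theorem abs_integral_mul_translate_sub_le {d : ℕ} {u : EuclideanSpace ℝ (Fin d) → ℝ}
    (hi : Integrable u) (hu : totalVariation u < ∞) {φ : EuclideanSpace ℝ (Fin d) → ℝ}
    (hφ : ContDiff ℝ 1 φ) (hc : HasCompactSupport φ) (h1 : ∀ x, |φ x| ≤ 1)
    (v : EuclideanSpace ℝ (Fin d)) :
    |∫ x, u x * (φ (x + v) - φ x)| ≤ ‖v‖ * (totalVariation u).toReal := by
  have hdc : Continuous (fderiv ℝ φ) := hφ.continuous_fderiv one_ne_zero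
  have hcont : Continuous fun p : EuclideanSpace ℝ (Fin d) × ℝ =>
      fderiv ℝ φ (p.1 + p.2 • v) v := by fun_prop
  have hftc : ∀ x, φ (x + v) - φ x = ∫ s in (0 : ℝ)..1, fderiv ℝ φ (x + s • v) v := by
    intro x
    rw [intervalIntegral.integral_eq_sub_of_hasDerivAt (f := fun s : ℝ => φ (x + s • v))]
    · simp
    · intro s _
      have h2 : HasDerivAt (fun s : ℝ => x + s • v) v s := by
        simpa using ((hasDerivAt_id s).smul_const v).const_add x
      exact (hφ.differentiable one_ne_zero _).hasFDerivAt.comp_hasDerivAt s h2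
    · exact (hcont.comp (Continuous.prodMk_right x)).intervalIntegrable _ _
  obtain ⟨B, hB⟩ : ∃ B, ∀ x, ‖fderiv ℝ φ x‖ ≤ B :=
    hdc.bounded_above_of_compact_support (hc.fderiv ℝ)
  have hint : Integrable (fun p : EuclideanSpace ℝ (Fin d) × ℝ =>
      u p.1 * fderiv ℝ φ (p.1 + p.2 • v) v)
      (volume.prod (volume.restrict (Ioc (0 : ℝ) 1))) := by
    refine Integrable.mul_bdd (c := B * ‖v‖) (hi.comp_fst _) hcont.aestronglyMeasurable
      (.of_forall fun p => ?_)
    exact (ContinuousLinearMap.le_opNorm _ _).trans (by gcongr; exact hB _)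
  have hswap : ∫ x, u x * (φ (x + v) - φ x) =
      ∫ s in (0 : ℝ)..1, ∫ x, u x * fderiv ℝ φ (x + s • v) v := by
    simp_rw [hftc, intervalIntegral.integral_of_le zero_le_one, ← integral_const_mul]
    exact integral_integral_swap hint
  rw [hswap, ← Real.norm_eq_abs]
  have := intervalIntegral.norm_integral_le_of_norm_le_const (a := (0 : ℝ)) (b := 1)
    (f := fun s => ∫ x, u x * fderiv ℝ φ (x + s • v) v)
    (C := ‖v‖ * (totalVariation u).toReal) (fun s _ => ?_)
  · simpa using this
  -- For each s the shifted function φ(· + s v) is again admissible, so the bound is uniform in s.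
  have hs : ∀ x, fderiv ℝ φ (x + s • v) = fderiv ℝ (fun y => φ (y + s • v)) x := fun x =>
    (fderiv_comp_add_right (s • v)).symm
  simp_rw [hs]
  exact abs_integral_mul_fderiv_le hu (hφ.comp (contDiff_id.add contDiff_const))
    (hc.comp_homeomorph (Homeomorph.addRight (s • v))) (fun x => h1 _) v

/-- A smooth function separating two disjoint compact sets. -/
theorem exists_contDiff_separating {V : Type*} [NormedAddCommGroup V] [NormedSpace ℝ V]
    [FiniteDimensional ℝ V] {K L : Set V} (hK : IsCompact K)
    (hL : IsCompact L) (hd : Disjoint K L) :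
    ∃ φ : V → ℝ, ContDiff ℝ 1 φ ∧ HasCompactSupport φ ∧
      (∀ x, φ x ∈ Icc (0 : ℝ) 1) ∧ (∀ x ∈ K, φ x = 1) ∧ ∀ x ∈ L, φ x = 0 := by
  obtain ⟨R, hR⟩ := hK.isBounded.subset_ball 0
  obtain ⟨f, h0, h1, h⟩ := exists_contMDiffMap_zero_one_of_isClosed
    (modelWithCornersSelf ℝ V) (n := 1) (s := L ∪ (Metric.ball 0 R)ᶜ) (t := K)
    (hL.isClosed.union Metric.isOpen_ball.isClosed_compl) hK.isClosed
    (disjoint_union_left.2 ⟨hd.symm, (disjoint_compl_right_iff_subset.2 hR).symm⟩)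
  refine ⟨f, f.contMDiff.contDiff, ?_, h, fun x hx => h1 hx, fun x hx => h0 (Or.inl hx)⟩
  refine HasCompactSupport.intro (isCompact_closedBall 0 R) fun x hx => h0 (Or.inr ?_)
  exact fun hx' => hx (Metric.ball_subset_closedBall hx')

/-- The part of `E` that leaves `E` under translation by `v` has measure at most `‖v‖ Per(E)`. -/
theorem volume_setOf_translate_notMem_le {d : ℕ} {E : Set (EuclideanSpace ℝ (Fin d))}
    (hE : HasFinitePerimeter E) (hm : MeasurableSet E) (v : EuclideanSpace ℝ (Fin d)) :
    volume {x | x ∈ E ∧ x + v ∉ E} ≤ ENNReal.ofReal ‖v‖ * perimeter E := by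
  set A := {x | x ∈ E ∧ x + v ∉ E} with hA
  set B := {x | x ∉ E ∧ x + v ∈ E} with hB
  have hEv : MeasurableSet {x | x + v ∈ E} := (measurable_add_const v) hm
  have hAm : MeasurableSet A := hm.inter hEv.compl
  have hBm : MeasurableSet B := hm.compl.inter hEv
  have hAf : volume A ≠ ∞ := ((measure_mono fun x hx => hx.1).trans_lt hE.1).ne
  have hEvf : volume {x | x + v ∈ E} = volume E := measure_preimage_add_right volume v E
  have hBf : volume B ≠ ∞ :=
    ((measure_mono fun x hx => hx.2).trans_lt (hEvf.trans_lt hE.1)).ne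
  have hPf : perimeter E ≠ ∞ := hE.2.2.ne
  suffices h : volume.real A ≤ ‖v‖ * (perimeter E).toReal by
    rw [← ENNReal.ofReal_toReal hAf, ← ENNReal.ofReal_toReal hPf,
      ← ENNReal.ofReal_mul (norm_nonneg v)]
    exact ENNReal.ofReal_le_ofReal h
  refine le_of_forall_pos_le_add fun ε hε => ?_
  have hε2 : ENNReal.ofReal (ε / 2) ≠ 0 := by simpa using hε
  -- The test function approximates χ_A on A ∪ B: it is 1 on K ⊆ A and 0 on L ⊆ B, each missing
  -- measure at most ε/2. Pairing χ_E with φ(· - v) - φ gives ∫_B φ - ∫_A φ, as the part over E ∩ (E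
  -- - v) cancels.
  obtain ⟨K, hKA, hK, hKε⟩ := hAm.exists_isCompact_sdiff_lt hAf hε2
  obtain ⟨L, hLB, hL, hLε⟩ := hBm.exists_isCompact_sdiff_lt hBf hε2
  have hAB : Disjoint A B := disjoint_left.2 fun x h h' => h'.1 h.1
  obtain ⟨φ, hφ, hc, h01, hφK, hφL⟩ := exists_contDiff_separating hK hL (hAB.mono hKA hLB)
  have hφi : Integrable φ := hφ.continuous.integrable_of_hasCompactSupport hc
  have habs : ∀ x, |φ x| ≤ 1 := fun x => abs_le.2 ⟨by linarith [(h01 x).1], (h01 x).2⟩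
  have key := abs_integral_mul_translate_sub_le hE.2.1 hE.2.2 hφ hc habs (-v)
  rw [norm_neg] at key
  have hchi : ∀ g : EuclideanSpace ℝ (Fin d) → ℝ, (fun x => chi E x * g x) = E.indicator g := by
    intro g
    funext x
    by_cases hx : x ∈ E <;> simp [chi, hx]
  have hφv : Integrable fun x => φ (x + -v) := hφi.comp_add_right (-v)
  have e1 : ∫ x, chi E x * (φ (x + -v) - φ x) =
      (∫ x in {x | x + v ∈ E}, φ x) - ∫ x in E, φ x := by
    rw [hchi fun x => φ (x + -v) - φ x, integral_indicator hm,
      integral_sub hφv.integrableOn hφi.integrableOn]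
    congr 1
    have := (measurePreserving_add_right volume (-v)).setIntegral_preimage_emb
      (Homeomorph.addRight (-v)).measurableEmbedding φ {x | x + v ∈ E}
    rw [← this]
    congr 2
    ext x
    simp
  have e2 : ∫ x in E, φ x = (∫ x in A, φ x) + ∫ x in E ∩ {x | x + v ∈ E}, φ x := by
    rw [← setIntegral_union _ (hm.inter hEv) hφi.integrableOn hφi.integrableOn]
    · congr 2; ext x; simp only [hA, mem_union, mem_inter_iff, mem_ofPred_eq]; tauto
    · exact disjoint_left.2 fun x h h' => h.2 h'.2
  have e3 : ∫ x in {x | x + v ∈ E}, φ x =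
      (∫ x in B, φ x) + ∫ x in E ∩ {x | x + v ∈ E}, φ x := by
    rw [← setIntegral_union _ (hm.inter hEv) hφi.integrableOn hφi.integrableOn]
    · congr 2; ext x; simp only [hB, mem_union, mem_inter_iff, mem_ofPred_eq]; tauto
    · exact disjoint_left.2 fun x h h' => h.1 h'.1
  have hdiff : ∀ {S T : Set (EuclideanSpace ℝ (Fin d))}, volume (S \ T) < ENNReal.ofReal (ε / 2) →
      volume.real (S \ T) ≤ ε / 2 := fun h =>
    ENNReal.toReal_le_of_le_ofReal (by linarith) h.le
  have l1 : volume.real A - ε / 2 ≤ ∫ x in A, φ x := by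
    have hK1 : ∫ x in K, φ x = volume.real K := by
      rw [setIntegral_congr_fun hK.measurableSet hφK]; simp
    have h2 : ∫ x in K, φ x ≤ ∫ x in A, φ x :=
      setIntegral_mono_set hφi.integrableOn (.of_forall fun x => (h01 x).1)
        (LE.le.eventuallyLE hKA)
    have h3 : volume.real A = volume.real K + volume.real (A \ K) := by
      rw [add_comm, measureReal_sdiff_add_inter hK.measurableSet hAf |>.symm,
        inter_eq_self_of_subset_right hKA]
    linarith [hdiff hKε]
  have l2 : ∫ x in B, φ x ≤ ε / 2 := by
    have h0 : ∫ x in B, φ x = (∫ x in L, φ x) + ∫ x in B \ L, φ x := by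
      rw [← setIntegral_union disjoint_sdiff_right (hBm.diff hL.measurableSet) hφi.integrableOn
        hφi.integrableOn, union_sdiff_cancel hLB]
    have h1 : ∫ x in L, φ x = 0 := by
      rw [setIntegral_congr_fun hL.measurableSet hφL]; simp
    have h2 : ∫ x in B \ L, φ x ≤ ∫ _ in B \ L, (1 : ℝ) :=
      setIntegral_mono hφi.integrableOn
        (integrableOn_const (measure_ne_top_of_subset sdiff_subset hBf))
        fun x => (h01 x).2
    rw [setIntegral_const, smul_eq_mul, mul_one] at h2
    linarith [hdiff hLε]
  change |∫ x, chi E x * (φ (x + -v) - φ x)| ≤ ‖v‖ * (perimeter E).toReal at key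
  rw [e1, e2, e3] at key
  linarith [(abs_le.1 key).1]

/-! ### Radial integrals of the kernel. -/

/-- Radial powers integrated in polar coordinates. -/
theorem setLIntegral_norm_rpow {d : ℕ} (hd : 1 ≤ d) (a : ℝ) {T : Set ℝ} (hT : MeasurableSet T)
    (hi : IntegrableOn (fun y : ℝ => y ^ ((d : ℝ) - 1 + a)) (T ∩ Ioi 0)) :
    ∫⁻ h : EuclideanSpace ℝ (Fin d) in norm ⁻¹' T, ENNReal.ofReal (‖h‖ ^ a) =
      ENNReal.ofReal (d * volume.real (Metric.ball (0 : EuclideanSpace ℝ (Fin d)) 1) *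
        ∫ y in T ∩ Ioi 0, y ^ ((d : ℝ) - 1 + a)) := by
  have : Nonempty (Fin d) := ⟨⟨0, hd⟩⟩
  have hpow : ∀ y ∈ Ioi (0 : ℝ), y ^ (Module.finrank ℝ (EuclideanSpace ℝ (Fin d)) - 1) •
      T.indicator (fun y => y ^ a) y = T.indicator (fun y => y ^ ((d : ℝ) - 1 + a)) y := by
    intro y hy
    have hy : 0 < y := hy
    by_cases hyT : y ∈ T
    · simp only [indicator_of_mem hyT, finrank_euclideanSpace, Fintype.card_fin, smul_eq_mul]
      rw [Real.rpow_add hy, ← Real.rpow_natCast, Nat.cast_sub hd, Nat.cast_one]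
    · simp [hyT]
  have hint : IntegrableOn (T.indicator fun y : ℝ => y ^ ((d : ℝ) - 1 + a)) (Ioi 0) := by
    rw [integrableOn_indicator_iff hT]
    exact hi
  have hint' : Integrable
      (fun h : EuclideanSpace ℝ (Fin d) => T.indicator (fun y => y ^ a) ‖h‖) := by
    rw [integrable_fun_norm_addHaar volume]
    exact hint.congr_fun (fun y hy => (hpow y hy).symm) measurableSet_Ioi
  have hval := integral_fun_norm_addHaar (volume : Measure (EuclideanSpace ℝ (Fin d)))
    (T.indicator fun y : ℝ => y ^ a)
  rw [setIntegral_congr_fun measurableSet_Ioi hpow, setIntegral_indicator hT, inter_comm,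
    finrank_euclideanSpace, Fintype.card_fin, nsmul_eq_mul, smul_eq_mul, ← mul_assoc] at hval
  have hnn : ∀ h : EuclideanSpace ℝ (Fin d), 0 ≤ T.indicator (fun y => y ^ a) ‖h‖ := fun h =>
    indicator_apply_nonneg fun _ => Real.rpow_nonneg (norm_nonneg h) a
  rw [← hval, ofReal_integral_eq_lintegral_ofReal hint' (.of_forall hnn),
    ← lintegral_indicator (measurable_norm hT)]
  refine lintegral_congr fun h => ?_
  by_cases hh : ‖h‖ ∈ T
  · rw [indicator_of_mem hh, indicator_of_mem (show h ∈ norm ⁻¹' T from hh)]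
  · rw [indicator_of_notMem hh, indicator_of_notMem (show h ∉ norm ⁻¹' T from hh)]
    simp

/-- The exponent α - d is that of the kernel, -(d + 1 - α), after one factor ‖h‖ is gained from the
translation estimate. -/
theorem setLIntegral_norm_rpow_near {d : ℕ} (hd : 1 ≤ d) {α r : ℝ} (hα : 0 < α) (hr : 0 < r) :
    ∫⁻ h : EuclideanSpace ℝ (Fin d) in norm ⁻¹' Iio r, ENNReal.ofReal (‖h‖ ^ (α - d)) =
      ENNReal.ofReal (d * volume.real (Metric.ball (0 : EuclideanSpace ℝ (Fin d)) 1) / α) *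
        ENNReal.ofReal (r ^ α) := by
  have hexp : (d : ℝ) - 1 + (α - d) = α - 1 := by ring
  have hset : Iio r ∩ Ioi 0 = Ioo 0 r := by rw [inter_comm, Ioi_inter_Iio]
  have hi : IntegrableOn (fun y : ℝ => y ^ (α - 1)) (Ioc 0 r) :=
    (intervalIntegrable_iff_integrableOn_Ioc_of_le hr.le).1
      (intervalIntegral.intervalIntegrable_rpow' (by linarith))
  rw [setLIntegral_norm_rpow hd _ measurableSet_Iio
    (by rw [hexp, hset]; exact hi.mono_set Ioo_subset_Ioc_self), hexp, hset,
    ← integral_Ioc_eq_integral_Ioo, ← intervalIntegral.integral_of_le hr.le,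
    integral_rpow (Or.inl (by linarith)), ← ENNReal.ofReal_mul (by positivity)]
  congr 1
  rw [sub_add_cancel, Real.zero_rpow hα.ne']
  ring

theorem setLIntegral_norm_rpow_far {d : ℕ} (hd : 1 ≤ d) {s r : ℝ} (hs : 0 < s) (hr : 0 < r) :
    ∫⁻ h : EuclideanSpace ℝ (Fin d) in norm ⁻¹' Ici r, ENNReal.ofReal (‖h‖ ^ (-(d + s))) =
      ENNReal.ofReal (d * volume.real (Metric.ball (0 : EuclideanSpace ℝ (Fin d)) 1) / s) *
        ENNReal.ofReal (r ^ (-s)) := by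
  have hexp : (d : ℝ) - 1 + (-(d + s)) = -s - 1 := by ring
  have hset : Ici r ∩ Ioi 0 = Ici r := inter_eq_left.2 fun y hy => lt_of_lt_of_le hr hy
  have hi : IntegrableOn (fun y : ℝ => y ^ (-s - 1)) (Ioi r) :=
    integrableOn_Ioi_rpow_of_lt (by linarith) hr
  rw [setLIntegral_norm_rpow hd _ measurableSet_Ici
    (by rw [hexp, hset]; exact (integrableOn_Ici_iff_integrableOn_Ioi).2 hi), hexp, hset,
    integral_Ici_eq_integral_Ioi, integral_Ioi_rpow_of_lt (by linarith) hr,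
    ← ENNReal.ofReal_mul (by positivity)]
  congr 1
  rw [sub_add_cancel]
  field_simp

/-! ### Splitting the fractional derivative at radius r. -/

theorem fracDeriv_eq_lintegral_translate {d : ℕ} (s : ℝ) (u : EuclideanSpace ℝ (Fin d) → ℝ)
    (x : EuclideanSpace ℝ (Fin d)) :
    fracDeriv s u x =
      ∫⁻ h, ENNReal.ofReal |u x - u (x + h)| * ENNReal.ofReal (‖h‖ ^ (-((d : ℝ) + s))) := by
  rw [fracDeriv, ← lintegral_add_left_eq_self _ x]
  refine lintegral_congr fun h => ?_
  rw [← ENNReal.ofReal_mul (abs_nonneg _), sub_add_cancel_left, norm_neg,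
    Real.rpow_neg (norm_nonneg h), div_eq_mul_inv]

/-- The integrand is the indicator of two one-sided differences. Shifting the second by h puts it in
the form of the first, with -h in place of h. -/
theorem lintegral_chi_translate_le {d : ℕ} {E : Set (EuclideanSpace ℝ (Fin d))}
    (hm : MeasurableSet E) (h : EuclideanSpace ℝ (Fin d)) :
    ∫⁻ x, ENNReal.ofReal |chi E x - chi E (x + h)| ≤
      volume {x | x ∈ E ∧ x + h ∉ E} + volume {x | x ∈ E ∧ x + -h ∉ E} := by
  have hEv : MeasurableSet {x | x + h ∈ E} := (measurable_add_const h) hm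
  have hA : MeasurableSet {x | x ∈ E ∧ x + h ∉ E} := hm.inter hEv.compl
  have hB : MeasurableSet {x | x ∉ E ∧ x + h ∈ E} := hm.compl.inter hEv
  have hBv : volume {x | x ∈ E ∧ x + -h ∉ E} = volume {x | x ∉ E ∧ x + h ∈ E} := by
    rw [← measure_preimage_add_right volume h {x | x ∈ E ∧ x + -h ∉ E}]
    congr 1
    ext x
    simp [and_comm]
  rw [hBv, ← lintegral_indicator_one hA, ← lintegral_indicator_one hB,
    ← lintegral_add_left (measurable_one.indicator hA)]
  refine lintegral_mono fun x => ?_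
  by_cases h1 : x ∈ E <;> by_cases h2 : x + h ∈ E <;> simp [chi, h1, h2]

theorem lintegral_chi_translate_le_perimeter {d : ℕ} {E : Set (EuclideanSpace ℝ (Fin d))}
    (hE : HasFinitePerimeter E) (hm : MeasurableSet E) (h : EuclideanSpace ℝ (Fin d)) :
    ∫⁻ x, ENNReal.ofReal |chi E x - chi E (x + h)| ≤ 2 * perimeter E * ENNReal.ofReal ‖h‖ := by
  refine (lintegral_chi_translate_le hm h).trans ?_
  have h1 := volume_setOf_translate_notMem_le hE hm h
  have h2 := volume_setOf_translate_notMem_le hE hm (-h)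
  rw [norm_neg] at h2
  exact (add_le_add h1 h2).trans_eq (by ring)

theorem lintegral_chi_translate_le_volume {d : ℕ} {E : Set (EuclideanSpace ℝ (Fin d))}
    (hm : MeasurableSet E) (h : EuclideanSpace ℝ (Fin d)) :
    ∫⁻ x, ENNReal.ofReal |chi E x - chi E (x + h)| ≤ 2 * volume E :=
  (lintegral_chi_translate_le hm h).trans
    ((add_le_add (measure_mono fun _ hx => hx.1) (measure_mono fun _ hx => hx.1)).trans_eq
      (two_mul _).symm)

theorem measurable_chi {d : ℕ} {E : Set (EuclideanSpace ℝ (Fin d))} (hm : MeasurableSet E) :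
    Measurable (chi E) := measurable_const.indicator hm

/-- The part of the integral defining `fracDeriv s u` over displacements of length in `T`. -/
noncomputable def truncFracDeriv {d : ℕ} (s : ℝ) (u : EuclideanSpace ℝ (Fin d) → ℝ) (T : Set ℝ)
    (x : EuclideanSpace ℝ (Fin d)) : ℝ≥0∞ :=
  ∫⁻ h in norm ⁻¹' T, ENNReal.ofReal |u x - u (x + h)| * ENNReal.ofReal (‖h‖ ^ (-((d : ℝ) + s)))

theorem measurable_translate_kernel {d : ℕ} {s : ℝ} {u : EuclideanSpace ℝ (Fin d) → ℝ}
    (hu : Measurable u) :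
    Measurable fun p : EuclideanSpace ℝ (Fin d) × EuclideanSpace ℝ (Fin d) =>
      ENNReal.ofReal |u p.1 - u (p.1 + p.2)| * ENNReal.ofReal (‖p.2‖ ^ (-((d : ℝ) + s))) := by
  have h1 : Measurable fun p : EuclideanSpace ℝ (Fin d) × EuclideanSpace ℝ (Fin d) =>
      |u p.1 - u (p.1 + p.2)| := by
    simp_rw [← Real.norm_eq_abs]
    exact ((hu.comp measurable_fst).sub (hu.comp (measurable_fst.add measurable_snd))).norm
  exact h1.ennreal_ofReal.mul (measurable_snd.norm.pow_const _).ennreal_ofReal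

theorem measurable_truncFracDeriv {d : ℕ} {s : ℝ} {u : EuclideanSpace ℝ (Fin d) → ℝ}
    (hu : Measurable u) (T : Set ℝ) : Measurable (truncFracDeriv s u T) :=
  (measurable_translate_kernel hu).lintegral_prod_right'

theorem fracDeriv_eq_near_add_far {d : ℕ} {s : ℝ} {u : EuclideanSpace ℝ (Fin d) → ℝ} (r : ℝ)
    (x : EuclideanSpace ℝ (Fin d)) :
    fracDeriv s u x = truncFracDeriv s u (Iio r) x + truncFracDeriv s u (Ici r) x := by
  rw [fracDeriv_eq_lintegral_translate, truncFracDeriv, truncFracDeriv, ← compl_Iio,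
    preimage_compl, lintegral_add_compl _ (measurable_norm measurableSet_Iio)]

theorem lintegral_truncFracDeriv {d : ℕ} {s : ℝ} {u : EuclideanSpace ℝ (Fin d) → ℝ}
    (hu : Measurable u) (T : Set ℝ) :
    ∫⁻ x, truncFracDeriv s u T x = ∫⁻ h in norm ⁻¹' T,
      (∫⁻ x, ENNReal.ofReal |u x - u (x + h)|) * ENNReal.ofReal (‖h‖ ^ (-((d : ℝ) + s))) := by
  simp only [truncFracDeriv]
  rw [lintegral_lintegral_swap (measurable_translate_kernel hu).aemeasurable]
  refine lintegral_congr fun h => lintegral_mul_const' _ _ ENNReal.ofReal_ne_top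

/-- `∫₀ᵗ f^*` for `f = 𝒟^{1-α}(χ_E)`, bounded through the splitting of the singular integral at
radius `r`. -/
theorem exists_lintegral_rearrangement_fracDeriv_le {d : ℕ} (hd : 1 ≤ d) {α : ℝ} (hα₀ : 0 < α)
    (hα₁ : α < 1) :
    ∃ c : ℝ≥0, ∀ E : Set (EuclideanSpace ℝ (Fin d)), HasFinitePerimeter E → MeasurableSet E →
      ∀ r t : ℝ, 0 < r →
        ∫⁻ y in Ioc 0 t, rearrangement (fracDeriv (1 - α) (chi E)) y ≤
          c * (perimeter E * ENNReal.ofReal (r ^ α) +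
            min (ENNReal.ofReal t) (volume E) * ENNReal.ofReal (r ^ (α - 1))) := by
  set ω : ℝ := d * volume.real (Metric.ball (0 : EuclideanSpace ℝ (Fin d)) 1)
  have hω : 0 ≤ ω := by positivity
  have hs : 0 < 1 - α := by linarith
  set a : ℝ≥0∞ := ENNReal.ofReal (ω / α)
  set b : ℝ≥0∞ := ENNReal.ofReal (ω / (1 - α))
  have htop : 2 * a + 2 * b ≠ ∞ := by finiteness
  refine ⟨(2 * a + 2 * b).toNNReal, fun E hE hm r t hr => ?_⟩
  rw [ENNReal.coe_toNNReal htop]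
  have hu := measurable_chi hm
  set u := chi E
  have hP : perimeter E ≠ ∞ := hE.2.2.ne
  have near : ∫⁻ x, truncFracDeriv (1 - α) u (Iio r) x ≤
      2 * perimeter E * (a * ENNReal.ofReal (r ^ α)) := by
    rw [lintegral_truncFracDeriv hu, ← setLIntegral_norm_rpow_near hd hα₀ hr,
      ← lintegral_const_mul' _ _ (ENNReal.mul_ne_top (by simp) hP)]
    refine lintegral_mono fun h => ?_
    refine (mul_le_mul_left (lintegral_chi_translate_le_perimeter hE hm h) _).trans ?_
    rw [mul_assoc]
    gcongr
    rw [← ENNReal.ofReal_mul (norm_nonneg h)]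
    apply ENNReal.ofReal_le_ofReal
    rcases eq_or_ne h 0 with rfl | hh
    · rw [norm_zero, zero_mul]
      exact Real.rpow_nonneg le_rfl _
    · have hh : 0 < ‖h‖ := norm_pos_iff.2 hh
      rw [← Real.rpow_one_add' hh.le (by linarith [(Nat.one_le_cast (α := ℝ)).2 hd])]
      exact le_of_eq (by congr 1; ring)
  -- Used with k = 1 for the sup bound and k = 2|E| for the L¹ bound.
  have far : ∀ k : ℝ≥0∞, k ≠ ∞ → ∫⁻ h in norm ⁻¹' Ici r,
      k * ENNReal.ofReal (‖h‖ ^ (-((d : ℝ) + (1 - α)))) =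
        k * (b * ENNReal.ofReal (r ^ (α - 1))) := fun k hk => by
    rw [lintegral_const_mul' _ _ hk, setLIntegral_norm_rpow_far hd hs hr, neg_sub]
  have far_sup : ∀ x, truncFracDeriv (1 - α) u (Ici r) x ≤ b * ENNReal.ofReal (r ^ (α - 1)) := by
    intro x
    rw [← one_mul (b * _), ← far 1 ENNReal.one_ne_top]
    refine lintegral_mono fun h => ?_
    gcongr
    refine ENNReal.ofReal_le_one.2 ?_
    by_cases h1 : x ∈ E <;> by_cases h2 : x + h ∈ E <;> simp [u, chi, h1, h2]
  have far_int : ∫⁻ x, truncFracDeriv (1 - α) u (Ici r) x ≤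
      2 * volume E * (b * ENNReal.ofReal (r ^ (α - 1))) := by
    rw [lintegral_truncFracDeriv hu, ← far _ (ENNReal.mul_ne_top (by simp) hE.1.ne)]
    refine lintegral_mono fun h => ?_
    gcongr
    exact lintegral_chi_translate_le_volume hm h
  have hnear := measurable_truncFracDeriv (s := 1 - α) hu (Iio r)
  have hfar := measurable_truncFracDeriv (s := 1 - α) hu (Ici r)
  have bound : ∀ m : ℝ≥0∞,
      2 * perimeter E * (a * ENNReal.ofReal (r ^ α)) +
        2 * m * (b * ENNReal.ofReal (r ^ (α - 1))) ≤
      (2 * a + 2 * b) * (perimeter E * ENNReal.ofReal (r ^ α) +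
            m * ENNReal.ofReal (r ^ (α - 1))) := fun m => by
    calc _ = 2 * a * (perimeter E * ENNReal.ofReal (r ^ α)) +
          2 * b * (m * ENNReal.ofReal (r ^ (α - 1))) := by ring
      _ ≤ _ := by
        rw [mul_add]
        gcongr
        · exact le_self_add
        · exact le_add_self
  -- If the minimum is t, the far part is the bounded summand M. If it is |E|, both parts are put in
  -- L¹ and M = 0.
  rcases min_choice (ENNReal.ofReal t) (volume E) with h | h <;> rw [h] <;>
    refine le_trans ?_ (bound _)
  · refine (lintegral_rearrangement_le_add hnear (M := b * ENNReal.ofReal (r ^ (α - 1)))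
      (fun x => ?_) t).trans (add_le_add near ?_)
    · rw [fracDeriv_eq_near_add_far r]
      gcongr
      exact far_sup x
    · rw [mul_comm, mul_assoc 2]
      exact le_mul_of_one_le_left' one_le_two
  · refine (lintegral_rearrangement_le_add (hnear.add hfar) (M := 0) (fun x => ?_) t).trans ?_
    · rw [fracDeriv_eq_near_add_far r, add_zero]
      rfl
    · simp only [Pi.add_apply]
      rw [zero_mul, add_zero, lintegral_add_left hnear]
      exact add_le_add near far_int

/-! ### Invariance under modification on null sets. -/

theorem chi_congr_ae {d : ℕ} {E F : Set (EuclideanSpace ℝ (Fin d))} (h : E =ᵐ[volume] F) :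
    chi E =ᵐ[volume] chi F :=
  indicator_ae_eq_of_ae_eq_set h

theorem totalVariation_congr_ae {d : ℕ} {u w : EuclideanSpace ℝ (Fin d) → ℝ}
    (h : u =ᵐ[volume] w) : totalVariation u = totalVariation w := by
  have : ∀ Φ, ∫ x, u x * divergence Φ x = ∫ x, w x * divergence Φ x := fun Φ =>
    integral_congr_ae (h.mul (ae_eq_refl (divergence Φ)))
  simp only [totalVariation, this]

theorem fracDeriv_congr_ae {d : ℕ} {u w : EuclideanSpace ℝ (Fin d) → ℝ}
    (h : u =ᵐ[volume] w) (s : ℝ) : fracDeriv s u =ᵐ[volume] fracDeriv s w := by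
  filter_upwards [h] with x hx
  refine lintegral_congr_ae ?_
  filter_upwards [h] with y hy
  rw [hx, hy]

theorem HasFinitePerimeter.nullMeasurableSet {d : ℕ} {E : Set (EuclideanSpace ℝ (Fin d))}
    (hE : HasFinitePerimeter E) : NullMeasurableSet E := by
  have h := hE.2.1.aestronglyMeasurable
  have h2 : NullMeasurableSet (chi E ⁻¹' {1}) :=
    h.aemeasurable.nullMeasurable (measurableSet_singleton 1)
  convert h2 using 1
  ext x
  by_cases hx : x ∈ E <;> simp [chi, hx]

/-- Disposes of the degenerate case |E| = 0, where the optimal radius and the integral in t are not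
available. -/
theorem perimeter_eq_zero_of_volume_eq_zero {d : ℕ} {E : Set (EuclideanSpace ℝ (Fin d))}
    (h : volume E = 0) : perimeter E = 0 := by
  have h0 : chi E =ᵐ[volume] chi ∅ := chi_congr_ae (ae_eq_empty.2 h)
  rw [perimeter, totalVariation_congr_ae h0]
  simp [totalVariation, chi]

/-! ### Optimisation in r, integration in t, and the conclusion. -/

/-- Cut at t = v: below, the integrand is t^{α-β-1}, integrable at 0 since β < α; above, it is v^α
t^{-1-β}, integrable at ∞ since β > 0. -/
theorem lintegral_rpow_mul_min_rpow_le {α β v : ℝ} (hβ : 0 < β) (hβα : β < α) (hv : 0 < v) :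
    ∫⁻ t in Ioi (0 : ℝ), ENNReal.ofReal (t ^ (-1 - β) * min t v ^ α) ≤
      ENNReal.ofReal ((1 / (α - β) + 1 / β) * v ^ (α - β)) := by
  have hi1 : IntegrableOn (fun t : ℝ => t ^ (α - β - 1)) (Ioc 0 v) :=
    (intervalIntegrable_iff_integrableOn_Ioc_of_le hv.le).1
      (intervalIntegral.intervalIntegrable_rpow' (by linarith))
  have hi2 : IntegrableOn (fun t : ℝ => t ^ (-1 - β) * v ^ α) (Ioi v) :=
    (integrableOn_Ioi_rpow_of_lt (by linarith) hv).mul_const _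
  have e1 : ∫⁻ t in Ioc 0 v, ENNReal.ofReal (t ^ (-1 - β) * min t v ^ α) =
      ENNReal.ofReal (1 / (α - β) * v ^ (α - β)) := by
    rw [setLIntegral_congr_fun (g := fun t => ENNReal.ofReal (t ^ (α - β - 1))) measurableSet_Ioc
      fun t ht => ?_]
    · rw [← ofReal_integral_eq_lintegral_ofReal hi1
        ((ae_restrict_mem measurableSet_Ioc).mono fun t ht => Real.rpow_nonneg ht.1.le _),
        ← intervalIntegral.integral_of_le hv.le, integral_rpow (Or.inl (by linarith)),
        sub_add_cancel, Real.zero_rpow (by linarith)]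
      congr 1
      ring
    · have ht0 : 0 < t := ht.1
      simp only [min_eq_left ht.2]
      rw [← Real.rpow_add ht0]
      congr 2
      ring
  have e2 : ∫⁻ t in Ioi v, ENNReal.ofReal (t ^ (-1 - β) * min t v ^ α) =
      ENNReal.ofReal (1 / β * v ^ (α - β)) := by
    rw [setLIntegral_congr_fun (g := fun t => ENNReal.ofReal (t ^ (-1 - β) * v ^ α))
      measurableSet_Ioi fun t ht => by simp only [min_eq_right (mem_Ioi.1 ht).le]]
    rw [← ofReal_integral_eq_lintegral_ofReal hi2
      ((ae_restrict_mem measurableSet_Ioi).mono fun t ht =>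
        mul_nonneg (Real.rpow_nonneg (hv.trans ht).le _) (Real.rpow_nonneg hv.le _)),
      integral_mul_const, integral_Ioi_rpow_of_lt (by linarith) hv]
    congr 1
    rw [show -1 - β + 1 = -β by ring, show α - β = -β + α by ring, Real.rpow_add hv]
    field_simp
  rw [← Ioc_union_Ioi_eq_Ioi hv.le, add_mul,
    ENNReal.ofReal_add (mul_nonneg (one_div_nonneg.2 (by linarith)) (Real.rpow_nonneg hv.le _))
      (by positivity), ← e1, ← e2]
  exact lintegral_union_le _ _ _

/-- Optimising the splitting radius in the bound for `∫₀ᵗ f^*`. -/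
theorem exists_lintegral_rearrangement_fracDeriv_le_min {d : ℕ} (hd : 1 ≤ d) {α : ℝ}
    (hα₀ : 0 < α) (hα₁ : α < 1) :
    ∃ c : ℝ≥0, ∀ E : Set (EuclideanSpace ℝ (Fin d)), HasFinitePerimeter E → MeasurableSet E →
      ∀ t : ℝ, 0 < t →
        ∫⁻ y in Ioc 0 t, rearrangement (fracDeriv (1 - α) (chi E)) y ≤
          ENNReal.ofReal (c * (perimeter E).toReal ^ (1 - α) * min t (volume E).toReal ^ α) := by
  obtain ⟨c, hc⟩ := exists_lintegral_rearrangement_fracDeriv_le hd hα₀ hα₁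
  refine ⟨2 * c, fun E hE hm t ht => ?_⟩
  have hP : perimeter E ≠ ∞ := hE.2.2.ne
  have hV : volume E ≠ ∞ := hE.1.ne
  -- For zero perimeter only the term with r^{α-1} survives, and r → ∞ shows that the left side
  -- vanishes.
  rcases eq_or_ne (perimeter E) 0 with hP0 | hP0
  · refine le_trans (le_of_eq ?_) zero_le
    have hlim : Filter.Tendsto (fun r : ℝ => (c : ℝ≥0∞) * (min (ENNReal.ofReal t) (volume E) *
        ENNReal.ofReal (r ^ (α - 1)))) Filter.atTop (nhds 0) := by
      have h1 : Filter.Tendsto (fun r : ℝ => ENNReal.ofReal (r ^ (-(1 - α)))) Filter.atTop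
          (nhds 0) := by
        simpa using ENNReal.tendsto_ofReal (tendsto_rpow_neg_atTop (y := 1 - α) (by linarith))
      rw [neg_sub] at h1
      have h2 := ENNReal.Tendsto.const_mul (a := c * min (ENNReal.ofReal t) (volume E)) h1
        (Or.inr (ENNReal.mul_ne_top ENNReal.coe_ne_top (by simp)))
      simpa [mul_assoc] using h2
    refine le_antisymm (ge_of_tendsto hlim ?_) zero_le
    filter_upwards [Filter.eventually_gt_atTop 0] with r hr
    simpa [hP0] using hc E hE hm r t hr
  · have hV0 : volume E ≠ 0 := fun h => hP0 (perimeter_eq_zero_of_volume_eq_zero h)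
    set p := (perimeter E).toReal with hp
    set v := (volume E).toReal with hv
    have hp0 : 0 < p := ENNReal.toReal_pos hP0 hP
    have hv0 : 0 < v := ENNReal.toReal_pos hV0 hV
    set m := min t v
    have hm0 : 0 < m := lt_min ht hv0
    have hmin : min (ENNReal.ofReal t) (volume E) = ENNReal.ofReal m := by
      rw [← ENNReal.ofReal_toReal hV, ← ENNReal.ofReal_min]
    -- This radius balances the two terms: both become p^{1-α} m^α, whence the factor 2 in the
    -- constant.
    have key := hc E hE hm (m / p) t (by positivity)
    rw [hmin, ← ENNReal.ofReal_toReal hP, ← hp, ← ENNReal.ofReal_mul hp0.le,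
      ← ENNReal.ofReal_mul hm0.le, ← ENNReal.ofReal_add (by positivity) (by positivity),
      ← ENNReal.ofReal_coe_nnreal, ← ENNReal.ofReal_mul c.coe_nonneg] at key
    refine key.trans_eq ?_
    congr 1
    have h1 : p * (m / p) ^ α = p ^ (1 - α) * m ^ α := by
      rw [Real.div_rpow hm0.le hp0.le, Real.rpow_sub hp0, Real.rpow_one]
      ring
    have h2 : m * (m / p) ^ (α - 1) = p ^ (1 - α) * m ^ α := by
      rw [Real.div_rpow hm0.le hp0.le, Real.rpow_sub hp0, Real.rpow_sub hp0, Real.rpow_sub hm0,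
        Real.rpow_one, Real.rpow_one]
      have := (Real.rpow_pos_of_pos hp0 α).ne'
      field_simp
    rw [h1, h2]
    push_cast
    ring

/-- The estimate for Borel sets. -/
theorem exists_lorentzNorm_fracDeriv_chi_le {d : ℕ} (hd : 2 ≤ d) {α : ℝ}
    (hα₀ : 0 < α) (hα₁ : α < 1) :
    ∃ C : ℝ≥0, 0 < C ∧
      ∀ E : Set (EuclideanSpace ℝ (Fin d)), HasFinitePerimeter E → MeasurableSet E →
        lorentzNorm ((d : ℝ) / ((d : ℝ) - α)) 1 (fracDeriv (1 - α) (chi E)) ≤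
          (C : ℝ≥0∞) * perimeter E ^ (1 - α) * volume E ^ (α * (1 - 1 / (d : ℝ))) := by
  obtain ⟨c, hc⟩ := exists_lintegral_rearrangement_fracDeriv_le_min (d := d) (by omega) hα₀ hα₁
  have hd2 : (2 : ℝ) ≤ d := by exact_mod_cast hd
  set β := α / d with hβ
  have hβ0 : 0 < β := by positivity
  have hβα : β < α := div_lt_self hα₀ (by linarith)
  have hθ : α * (1 - 1 / (d : ℝ)) = α - β := by rw [hβ]; ring
  have hq : 1 / ((d : ℝ) / ((d : ℝ) - α)) = 1 - β := by
    rw [hβ, one_div_div, sub_div, div_self (by linarith)]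
  have hk : 0 < 1 / (α - β) + 1 / β := by
    have : 0 < α - β := by linarith
    positivity
  -- The summand 1 only makes the constant positive when c = 0.
  refine ⟨c * (1 / (α - β) + 1 / β).toNNReal + 1, by positivity, fun E hE hm => ?_⟩
  have hP : perimeter E ≠ ∞ := hE.2.2.ne
  have hV : volume E ≠ ∞ := hE.1.ne
  set p := (perimeter E).toReal with hp
  set v := (volume E).toReal with hv
  have hp0 : 0 ≤ p := ENNReal.toReal_nonneg
  have hbound : lorentzNorm ((d : ℝ) / ((d : ℝ) - α)) 1 (fracDeriv (1 - α) (chi E)) ≤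
      ENNReal.ofReal (c * p ^ (1 - α)) *
        ∫⁻ t in Ioi (0 : ℝ), ENNReal.ofReal (t ^ (-1 - β) * min t v ^ α) := by
    simp only [lorentzNorm, div_one, ENNReal.rpow_one]
    rw [← lintegral_const_mul' _ _ ENNReal.ofReal_ne_top, hq]
    refine setLIntegral_mono' measurableSet_Ioi fun t ht => ?_
    have ht : 0 < t := ht
    have h1 : averagedRearrangement (fracDeriv (1 - α) (chi E)) t ≤
        ENNReal.ofReal (c * p ^ (1 - α) * min t v ^ α / t) := by
      rw [ENNReal.ofReal_div_of_pos ht]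
      exact ENNReal.div_le_div_right (hc E hE hm t ht) _
    calc _ ≤ ENNReal.ofReal t ^ (1 - β) *
          ENNReal.ofReal (c * p ^ (1 - α) * min t v ^ α / t) / ENNReal.ofReal t := by gcongr
      _ = _ := by
        rw [ENNReal.ofReal_rpow_of_pos ht, ← ENNReal.ofReal_mul (by positivity),
          ← ENNReal.ofReal_div_of_pos ht, ← ENNReal.ofReal_mul (by positivity)]
        congr 1
        -- Of the two powers of t removed from t^{1-β}, one comes from the average f^{**} and one
        -- from dt/t.
        rw [show (1 : ℝ) - β = (-1 - β) + 1 + 1 by ring, Real.rpow_add ht, Real.rpow_add ht,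
          Real.rpow_one]
        field_simp
  rcases eq_or_ne (volume E) 0 with hV0 | hV0
  · have h0 : p = 0 := by rw [hp, perimeter_eq_zero_of_volume_eq_zero hV0, ENNReal.toReal_zero]
    refine hbound.trans ?_
    rw [h0, Real.zero_rpow (by linarith), mul_zero, ENNReal.ofReal_zero, zero_mul]
    exact zero_le
  have hv0 : 0 < v := ENNReal.toReal_pos hV0 hV
  refine (hbound.trans (mul_le_mul_right (lintegral_rpow_mul_min_rpow_le hβ0 hβα hv0) _)).trans ?_
  rw [← ENNReal.ofReal_toReal hP, ← ENNReal.ofReal_toReal hV, ← hp, ← hv, hθ,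
    ENNReal.ofReal_rpow_of_nonneg hp0 (by linarith), ENNReal.ofReal_rpow_of_pos hv0,
    ENNReal.ofReal_mul c.coe_nonneg, ENNReal.ofReal_mul hk.le, ENNReal.coe_add, ENNReal.coe_mul,
    ENNReal.ofReal_coe_nnreal]
  change _ ≤ ((c : ℝ≥0∞) * ENNReal.ofReal (1 / (α - β) + 1 / β) + 1) * _ * _
  calc _ = (c : ℝ≥0∞) * ENNReal.ofReal (1 / (α - β) + 1 / β) *
        ENNReal.ofReal (p ^ (1 - α)) * ENNReal.ofReal (v ^ (α - β)) := by ring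
    _ ≤ _ := by
      gcongr
      exact le_self_add

end FracPerimeter

theorem lemma1p2 (d : ℕ) (hd : 2 ≤ d) (α : ℝ) (hα₀ : 0 < α) (hα₁ : α < 1) :
    ∃ C : ℝ≥0, 0 < C ∧
      ∀ E : Set (EuclideanSpace ℝ (Fin d)), FracPerimeter.HasFinitePerimeter E →
        FracPerimeter.lorentzNorm ((d : ℝ) / ((d : ℝ) - α)) 1
            (FracPerimeter.fracDeriv (1 - α) (FracPerimeter.chi E)) ≤
          (C : ℝ≥0∞) * FracPerimeter.perimeter E ^ (1 - α) *
            volume E ^ (α * (1 - 1 / (d : ℝ))) := by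
  obtain ⟨C, hC0, hC⟩ := FracPerimeter.exists_lorentzNorm_fracDeriv_chi_le hd hα₀ hα₁
  refine ⟨C, hC0, fun E hE => ?_⟩
  -- E is only null-measurable, so it is replaced by a measurable set F equal to it almost
  -- everywhere; both sides of the inequality are unchanged.
  obtain ⟨F, -, hF, hFE⟩ := hE.nullMeasurableSet.exists_measurable_superset_ae_eq
  have hchi := FracPerimeter.chi_congr_ae hFE
  have hper : FracPerimeter.perimeter F = FracPerimeter.perimeter E :=
    FracPerimeter.totalVariation_congr_ae hchi
  have hvol : volume F = volume E := measure_congr hFE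
  have hF' : FracPerimeter.HasFinitePerimeter F :=
    ⟨hvol ▸ hE.1, hE.2.1.congr hchi.symm, lt_of_eq_of_lt hper hE.2.2⟩
  rw [← hper, ← hvol, ← FracPerimeter.lorentzNorm_congr_ae
    (FracPerimeter.fracDeriv_congr_ae hchi (1 - α))]
  exact hC F hF' hF
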